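/- All rings are associative with identity. For a ring $R$ let $\mathbf B(R)$ be its prime radical, the intersection of all prime two-sided ideals. For an idempotent $e$, the ring $eRe$ has identity $e$. A ring is semiprime if $aRa=0$ implies $a=0$; it is indecomposable if it is nonzero and its only central idempotents are $0$ and $1$. An idempotent $e\in R$ is Peirce trivial if $eR(1-e)Re=0=(1-e)ReR(1-e)$, and $\mathbf B$-trivial if $eR(1-e)Re$ and $(1-e)ReR(1-e)$ are contained in $\mathbf B(R)$. A $1$-Peirce ring is a nonzero ring whose only Peirce trivial idempotents are $0$ and $1$. A $1$-$\mathbf B$ ring is a nonzero ring whose only $\mathbf B$-trivial idempotents are $0$ and $1$; inductively, for $n>1$, $R$ is an $n$-$\mathbf B$ ring if there is a $\mathbf B$-trivial idempotent $e\in R$ such that $eRe$ is an $m$-$\mathbf B$ ring for some $1\le m<n$ and $(1-e)R(1-e)$ is an $(n-m)$-$\mathbf B$ ring. Call a finite family $e_1,\dots,e_n$ of elements of $R$ a complete family of orthogonal $1$-$\mathbf B$ idempotents if the $e_i$ are pairwise orthogonal $\mathbf B$-trivial idempotents with sum $1$ and every $e_iRe_i$ is a $1$-$\mathbf B$ ring.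 Theorem. Let $R$ be a ring. (1) For every $n\ge 1$, $R$ is an $n$-$\mathbf B$ ring if and only if $R/\mathbf B(R)$ is isomorphic to a direct sum (direct product) of $n$ semiprime $1$-Peirce rings. (2) $n$ is an invariant of $R$: if $R$ is both an $m$-$\mathbf B$ ring and an $n$-$\mathbf B$ ring, then $m=n$. If $R$ is an $n$-$\mathbf B$ ring, then it has a complete family $e_1,\dots,e_n$ of $n$ orthogonal $1$-$\mathbf B$ idempotents. (3) Let $e_1,\dots,e_n$ be any complete family of orthogonal $1$-$\mathbf B$ idempotents of $R$, and let $f\in R$ be a $\mathbf B$-trivial idempotent. Then there is $m$ with $0\le m\le n$ such that $f=f_1+\dots+f_m$ for pairwise orthogonal $\mathbf B$-trivial idempotents $f_j\in R$ for which every $f_jRf_j$ is a $1$-$\mathbf B$ ring (moreover, every $f_jRf_j$ is an indecomposable ring and its factor by its prime radical is a semiprime indecomposable ring), and there are $m$ distinct indices $i_1,\dots,i_m$ such that, for $e=e_{i_1}+\dots+e_{i_m}$, the left $R$-modules $Re$ and $Rf$ are isomorphic. (4) If $e_1,\dots,e_n$ and $f_1,\dots,f_m$ are two complete families of orthogonal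 $1$-$\mathbf B$ idempotents of $R$, then $m=n$ and there are a permutation $\sigma$ of $\{1,\dots,n\}$ and an invertible $u\in R$ such that $e_i=uf_{\sigma(i)}u^{-1}$ for all $i$. -/

import Mathlib

universe u

/-- A two-sided ideal `P` of a (not necessarily commutative) ring is prime if it is proper and
`a R b ⊆ P` implies `a ∈ P` or `b ∈ P`. -/
def IsPrimeTwoSided {R : Type u} [Ring R] (P : TwoSidedIdeal R) : Prop :=
  (1 : R) ∉ P ∧ ∀ a b : R, (∀ r : R, a * r * b ∈ P) → a ∈ P ∨ b ∈ P

/-- The prime (Baer) radical `B(R)`: the intersection of all prime two-sided ideals of `R`. -/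
def primeRadical (R : Type u) [Ring R] : TwoSidedIdeal R :=
  sInf {P | IsPrimeTwoSided P}

/-- The factor of `R` by its prime radical. -/
abbrev ModPrimeRadical (R : Type u) [Ring R] : Type u :=
  R ⧸ TwoSidedIdeal.asIdeal (primeRadical R)

/-- A ring is semiprime if `a R a = 0` implies `a = 0`. -/
def IsSemiprimeRing (R : Type u) [Ring R] : Prop :=
  ∀ a : R, (∀ r : R, a * r * a = 0) → a = 0

/-- A ring is indecomposable if it is nonzero and `0`, `1` are its only central idempotents. -/
def IsIndecomposableRing (R : Type u) [Ring R] : Prop :=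
  Nontrivial R ∧ ∀ e : R, IsIdempotentElem e → (∀ r : R, e * r = r * e) → e = 0 ∨ e = 1

/-- An idempotent `e` is Peirce trivial if `eR(1-e)Re = 0 = (1-e)ReR(1-e)`. -/
def IsPeirceTrivial {R : Type u} [Ring R] (e : R) : Prop :=
  IsIdempotentElem e ∧ (∀ r s : R, e * r * (1 - e) * s * e = 0) ∧
    ∀ r s : R, (1 - e) * r * e * s * (1 - e) = 0

/-- A `1`-Peirce ring: a nonzero ring whose only Peirce trivial idempotents are `0` and `1`. -/
def IsOnePeirceRing (R : Type u) [Ring R] : Prop :=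
  Nontrivial R ∧ ∀ e : R, IsPeirceTrivial e → e = 0 ∨ e = 1

/-- An idempotent `e` is `B`-trivial if `eR(1-e)Re` and `(1-e)ReR(1-e)` are contained in the
prime radical. -/
def IsBTrivial {R : Type u} [Ring R] (e : R) : Prop :=
  IsIdempotentElem e ∧ (∀ r s : R, e * r * (1 - e) * s * e ∈ primeRadical R) ∧
    ∀ r s : R, (1 - e) * r * e * s * (1 - e) ∈ primeRadical R

/-- A `1`-`B` ring: a nonzero ring whose only `B`-trivial idempotents are `0` and `1`. -/
def IsOneBRing (R : Type u) [Ring R] : Prop :=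
  Nontrivial R ∧ ∀ e : R, IsBTrivial e → e = 0 ∨ e = 1

/-- `IsNBRing n R`: `R` is an `n`-`B` ring (`n ≥ 1`). For an idempotent `e`, the ring `eRe`
with identity `e` is Mathlib's `IsIdempotentElem.Corner`. -/
inductive IsNBRing : ℕ → (R : Type u) → [Ring R] → Prop
  | one {R : Type u} [Ring R] (h : IsOneBRing R) : IsNBRing 1 R
  | step {R : Type u} [Ring R] {n m : ℕ} (hm : 1 ≤ m) (hmn : m < n)
      {e : R} (he : IsIdempotentElem e) (hB : IsBTrivial e)
      (h₁ : IsNBRing m he.Corner) (h₂ : IsNBRing (n - m) he.one_sub.Corner) : IsNBRing n R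

/-- A finite family of pairwise orthogonal `B`-trivial idempotents `e i`, all of whose corner
rings `(e i) R (e i)` are `1`-`B` rings. -/
structure IsOrthogonalOneBFamily {R : Type u} [Ring R] {n : ℕ} (e : Fin n → R) : Prop
    extends OrthogonalIdempotents e where
  bTrivial : ∀ i, IsBTrivial (e i)
  corner : ∀ i, IsOneBRing (idem i).Corner

/-!
Everything is read off in the semiprime ring `S = R / B(R)`, where `B(R)` is the prime radical.

In a semiprime ring an idempotent is Peirce trivial exactly when it is central
(`IsSemiprimeRing.isPeirceTrivial_iff`), so an idempotent `e` of `R` is `B`-trivial exactly when its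
image `ē` in `S` is central. The ideal `B(R)` is nil (an ideal maximal among those avoiding the
powers of a given element is prime), so idempotents lift from `S` to `R`, and no nonzero idempotent
dies in `S`; hence `R` is a `1`-`B` ring exactly when `S` is indecomposable. Since
`B(eRe) = eRe ∩ B(R)` (`mem_primeRadical_corner_iff`), the same applies to corner rings, with
`ēSē` in the place of `S`: an idempotent `e` is `B`-trivial with `eRe` a `1`-`B` ring exactly when
`ē` is a central primitive idempotent of `S`
(`IsPrimeRadicalQuotient.isCentralPrimitive_map_iff`).

Thus complete families of orthogonal `1`-`B` idempotents of `R` are the lifts of complete families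
of central primitive idempotents of `S`, which are the decompositions of `S` into a product of
indecomposable rings (`exists_family_iff_exists_ringEquiv`). Unwinding the recursive definition
shows that `R` is an `n`-`B` ring exactly when it has such a family of size `n`
(`isNBRing_iff_exists_family`). In `S` the family of central primitive idempotents is unique and
every central idempotent is a partial sum of it. Finally, families of idempotents `e`, `f` of `R`
with the same image in `S` are conjugate by `u = ∑ eᵢ fᵢ`, a unit because it is `1` modulo the nil
ideal `B(R)` (`IsPrimeRadicalQuotient.exists_unit_conj`); this gives the conjugacy of complete
families and the comparison of `Rf` with `Re`.
-/

universe v w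

/-! ### The prime radical -/

section PrimeRadical

variable {R : Type u} [Ring R]

lemma mem_primeRadical_iff {x : R} :
    x ∈ primeRadical R ↔ ∀ P : TwoSidedIdeal R, IsPrimeTwoSided P → x ∈ P :=
  TwoSidedIdeal.mem_sInf R

/-- The factor by the prime radical is semiprime. -/
lemma mem_primeRadical_of_mul_mul_mem {a : R} (h : ∀ r, a * r * a ∈ primeRadical R) :
    a ∈ primeRadical R := by
  rw [mem_primeRadical_iff]
  intro P hP
  exact (hP.2 a a fun r => mem_primeRadical_iff.1 (h r) P hP).elim id id

/-- A two-sided ideal that is maximal among those containing no power of `x` is prime. -/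
lemma isPrimeTwoSided_of_maximal {x : R} {P : TwoSidedIdeal R}
    (hP : Maximal (fun I : TwoSidedIdeal R => ∀ n : ℕ, x ^ n ∉ I) P) : IsPrimeTwoSided P := by
  refine ⟨by simpa using hP.1 0, fun a b hab => ?_⟩
  by_contra! h
  have key : ∀ (J : TwoSidedIdeal R) (c : R), P ≤ J → c ∈ J → c ∉ P → ∃ n : ℕ, x ^ n ∈ J := by
    intro J c hPJ hcJ hcP
    by_contra! hJ
    exact hcP (hP.2 hJ hPJ hcJ)
  -- `{z | z R b ⊆ P}` is an ideal containing `P` and `a`, hence some power of `x`.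
  obtain ⟨m, hm⟩ := key (.mk' {z | ∀ r, z * r * b ∈ P}
      (by simp [P.zero_mem])
      (fun hx hy r => by simpa [add_mul] using P.add_mem (hx r) (hy r))
      (fun hx r => by simpa using P.neg_mem (hx r))
      (fun {x y} hy r => by simpa [mul_assoc] using P.mul_mem_left x _ (hy r))
      (fun {x y} hx r => by simpa [mul_assoc] using hx (y * r))) a
    (fun z hz => (TwoSidedIdeal.mem_mk' ..).2 fun r =>
      P.mul_mem_right _ _ (P.mul_mem_right _ _ hz)) ((TwoSidedIdeal.mem_mk' ..).2 hab) h.1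
  rw [TwoSidedIdeal.mem_mk'] at hm
  -- `{z | x ^ m R z ⊆ P}` is an ideal containing `P` and `b`, hence some power of `x`.
  obtain ⟨n, hn⟩ := key (.mk' {z | ∀ r, x ^ m * r * z ∈ P}
      (by simp [P.zero_mem])
      (fun hx hy r => by simpa [mul_add] using P.add_mem (hx r) (hy r))
      (fun hx r => by simpa using P.neg_mem (hx r))
      (fun {x y} hy r => by simpa [mul_assoc] using hy (r * x))
      (fun {x y} hx r => by simpa [mul_assoc] using P.mul_mem_right _ y (hx r))) b
    (fun z hz => (TwoSidedIdeal.mem_mk' ..).2 fun r => P.mul_mem_left _ _ hz)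
    ((TwoSidedIdeal.mem_mk' ..).2 hm) h.2
  rw [TwoSidedIdeal.mem_mk'] at hn
  exact hP.1 (m + n) (by simpa [pow_add] using hn 1)

lemma isNilpotent_of_mem_primeRadical {x : R} (hx : x ∈ primeRadical R) : IsNilpotent x := by
  by_contra hnil
  obtain ⟨P, -, hP⟩ := zorn_le_nonempty₀ {I : TwoSidedIdeal R | ∀ n : ℕ, x ^ n ∉ I} (by
    intro c hc hchain J hJ
    refine ⟨.mk' {z | ∃ I ∈ c, z ∈ I} ⟨J, hJ, J.zero_mem⟩ ?_ ?_ ?_ ?_, ?_, ?_⟩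
    · rintro y z ⟨I, hI, hy⟩ ⟨I', hI', hz⟩
      obtain h | h := hchain.total hI hI'
      · exact ⟨I', hI', I'.add_mem (h hy) hz⟩
      · exact ⟨I, hI, I.add_mem hy (h hz)⟩
    · rintro y ⟨I, hI, hy⟩
      exact ⟨I, hI, I.neg_mem hy⟩
    · rintro y z ⟨I, hI, hz⟩
      exact ⟨I, hI, I.mul_mem_left _ _ hz⟩
    · rintro y z ⟨I, hI, hy⟩
      exact ⟨I, hI, I.mul_mem_right _ _ hy⟩
    · intro n hn
      obtain ⟨I, hI, hn⟩ := (TwoSidedIdeal.mem_mk' ..).1 hn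
      exact hc hI n hn
    · exact fun I hI z hz => (TwoSidedIdeal.mem_mk' ..).2 ⟨I, hI, hz⟩) ⊥
    (fun n hn => hnil ⟨n, (TwoSidedIdeal.mem_bot R).1 hn⟩)
  exact hP.1 1 (by simpa using mem_primeRadical_iff.1 hx P (isPrimeTwoSided_of_maximal hP))

lemma eq_zero_of_isIdempotentElem_of_mem_primeRadical {e : R} (he : IsIdempotentElem e)
    (h : e ∈ primeRadical R) : e = 0 := by
  obtain ⟨n, hn⟩ := isNilpotent_of_mem_primeRadical h
  rw [← he.pow_succ_eq n, pow_succ, hn, zero_mul]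

end PrimeRadical

/-! ### Corner rings -/

section Corner

variable {R : Type u} [Ring R] {e : R}

/-- The inclusion of the corner ring `eRe` into `R`; it preserves sums and products, but sends the
identity to `e`. -/
def cornerVal (he : IsIdempotentElem e) : he.Corner →ₙ+* R where
  toFun x := x.1
  map_mul' _ _ := rfl
  map_zero' := rfl
  map_add' _ _ := rfl

/-- The element `e r e` of the corner ring `eRe`. -/
def toCorner (he : IsIdempotentElem e) (r : R) : he.Corner := ⟨e * r * e, r, rfl⟩

variable {he : IsIdempotentElem e}

lemma cornerVal_injective : Function.Injective (cornerVal he) :=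
  fun _ _ h => Subtype.ext h

lemma cornerVal_one : cornerVal he 1 = e := rfl

lemma cornerVal_toCorner (r : R) : cornerVal he (toCorner he r) = e * r * e := rfl

lemma mul_cornerVal (x : he.Corner) : e * cornerVal he x = cornerVal he x :=
  ((Subsemigroup.mem_corner_iff he).1 x.2).1

lemma cornerVal_mul (x : he.Corner) : cornerVal he x * e = cornerVal he x :=
  ((Subsemigroup.mem_corner_iff he).1 x.2).2

lemma mul_cornerVal_assoc (x : he.Corner) (r : R) :
    e * (cornerVal he x * r) = cornerVal he x * r := by
  rw [← mul_assoc, mul_cornerVal]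

lemma cornerVal_mul_assoc (x : he.Corner) (r : R) :
    cornerVal he x * (e * r) = cornerVal he x * r := by
  rw [← mul_assoc, cornerVal_mul]

lemma toCorner_cornerVal (x : he.Corner) : toCorner he (cornerVal he x) = x :=
  cornerVal_injective (by rw [cornerVal_toCorner, mul_cornerVal, cornerVal_mul])

lemma toCorner_one : toCorner he 1 = 1 :=
  cornerVal_injective (by rw [cornerVal_toCorner, cornerVal_one, mul_one, he.eq])

lemma cornerVal_eq_zero_iff {x : he.Corner} : cornerVal he x = 0 ↔ x = 0 :=
  map_eq_zero_iff _ cornerVal_injective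

lemma isIdempotentElem_cornerVal_iff {x : he.Corner} :
    IsIdempotentElem (cornerVal he x) ↔ IsIdempotentElem x := by
  rw [IsIdempotentElem, IsIdempotentElem, ← map_mul, cornerVal_injective.eq_iff]

/-- `B(eRe) = eRe ∩ B(R)`: a prime of `R` not containing `e` meets `eRe` in a prime of `eRe`, and
a prime `P` of `eRe` is the trace of the prime `{x | eRxRe ⊆ P}` of `R`. -/
lemma mem_primeRadical_corner_iff {x : he.Corner} :
    x ∈ primeRadical he.Corner ↔ cornerVal he x ∈ primeRadical R := by
  simp only [mem_primeRadical_iff]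
  constructor
  · intro h Q hQ
    by_cases heQ : e ∈ Q
    · rw [← mul_cornerVal x]
      exact Q.mul_mem_right _ _ heQ
    have hx := h (.mk' {z | cornerVal he z ∈ Q} (by simp [Q.zero_mem])
      (fun hy hz => by simpa using Q.add_mem hy hz) (fun hy => by simpa using Q.neg_mem hy)
      (fun hz => by simpa using Q.mul_mem_left _ _ hz)
      (fun hy => by simpa using Q.mul_mem_right _ _ hy)) ⟨?_, ?_⟩
    · rwa [TwoSidedIdeal.mem_mk'] at hx
    · rwa [TwoSidedIdeal.mem_mk', Set.mem_ofPred_eq, cornerVal_one]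
    · intro a b hab
      simp only [TwoSidedIdeal.mem_mk', Set.mem_ofPred_eq] at hab ⊢
      refine hQ.2 _ _ fun r => ?_
      have := hab (toCorner he r)
      rwa [map_mul, map_mul, cornerVal_toCorner, ← mul_assoc, ← mul_assoc, cornerVal_mul,
        mul_assoc _ e, mul_cornerVal] at this
  · intro h P hP
    have hx := h (.mk' {z | ∀ a b, toCorner he (a * z * b) ∈ P} ?_ ?_ ?_ ?_ ?_) ⟨?_, ?_⟩
    · simpa [toCorner_cornerVal] using (TwoSidedIdeal.mem_mk' ..).1 hx 1 1
    · intro a b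
      convert P.zero_mem
      exact cornerVal_injective (by simp [cornerVal_toCorner])
    · intro y z hy hz a b
      convert P.add_mem (hy a b) (hz a b)
      exact cornerVal_injective (by simp [cornerVal_toCorner, mul_add, add_mul])
    · intro y hy a b
      convert P.neg_mem (hy a b)
      exact cornerVal_injective (by simp [cornerVal_toCorner])
    · intro y z hz a b
      simpa [mul_assoc] using hz (a * y) b
    · intro y z hy a b
      simpa [mul_assoc] using hy a (z * b)
    · intro h1
      exact hP.1 (by simpa [toCorner_one] using (TwoSidedIdeal.mem_mk' ..).1 h1 1 1)
    · intro r s hrs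
      simp only [TwoSidedIdeal.mem_mk', Set.mem_ofPred_eq] at hrs ⊢
      by_contra hcon
      simp only [not_or, not_forall] at hcon
      obtain ⟨⟨a, b, hab⟩, c, d, hcd⟩ := hcon
      refine (hP.2 _ _ fun y => ?_).elim hab hcd
      convert hrs (b * cornerVal he y * c) a d using 1
      refine cornerVal_injective ?_
      simp only [map_mul, cornerVal_toCorner, mul_assoc, mul_cornerVal_assoc, cornerVal_mul_assoc]

end Corner

/-! ### Central primitive idempotents -/

/-- A nonzero central idempotent `c` of a ring is central primitive if `0` and `c` are the only
central idempotents below `c`. -/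
structure IsCentralPrimitive {S : Type v} [Ring S] (c : S) : Prop where
  idem : IsIdempotentElem c
  central : ∀ s, c * s = s * c
  ne_zero : c ≠ 0
  eq_zero_or_eq : ∀ d, IsIdempotentElem d → (∀ s, d * s = s * d) → d * c = d → d = 0 ∨ d = c

section Central

variable {S : Type v} [Ring S]

lemma isCentralPrimitive_one_iff : IsCentralPrimitive (1 : S) ↔ IsIndecomposableRing S := by
  constructor
  · intro h
    exact ⟨⟨1, 0, h.ne_zero⟩, fun d hd hd' => h.eq_zero_or_eq d hd hd' (mul_one d)⟩
  · rintro ⟨_, h⟩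
    exact ⟨.one, by simp, one_ne_zero, fun d hd hd' _ => h d hd hd'⟩

lemma isCentralPrimitive_cornerVal_iff {c : S} (hc : IsIdempotentElem c)
    (hc' : ∀ s, c * s = s * c) {x : hc.Corner} :
    IsCentralPrimitive (cornerVal hc x) ↔ IsCentralPrimitive x := by
  have hcentral : ∀ y : hc.Corner,
      (∀ s, cornerVal hc y * s = s * cornerVal hc y) ↔ ∀ s, y * s = s * y := by
    refine fun y => ⟨fun h s => cornerVal_injective ?_, fun h s => ?_⟩
    · rw [map_mul, map_mul, h]
    · have := congrArg (cornerVal hc) (h (toCorner hc s))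
      rwa [map_mul, map_mul, cornerVal_toCorner, hc', mul_assoc s, hc.eq, mul_assoc s,
        mul_cornerVal, ← hc', cornerVal_mul_assoc] at this
  constructor
  · intro h
    refine ⟨isIdempotentElem_cornerVal_iff.1 h.idem, (hcentral x).1 h.central,
      fun h0 => h.ne_zero (by simp [h0]), fun d hd hd' hdx => ?_⟩
    simpa [cornerVal_eq_zero_iff, cornerVal_injective.eq_iff] using
      h.eq_zero_or_eq (cornerVal hc d) (isIdempotentElem_cornerVal_iff.2 hd) ((hcentral d).2 hd')
        (by rw [← map_mul, hdx])
  · intro h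
    refine ⟨isIdempotentElem_cornerVal_iff.2 h.idem, (hcentral x).2 h.central,
      fun h0 => h.ne_zero (cornerVal_eq_zero_iff.1 h0), fun d hd hd' hdx => ?_⟩
    obtain ⟨d, rfl⟩ : ∃ d', cornerVal hc d' = d := by
      refine ⟨toCorner hc d, ?_⟩
      rw [cornerVal_toCorner, hc', mul_assoc, hc.eq, ← hdx, mul_assoc, cornerVal_mul]
    rw [← map_mul, cornerVal_injective.eq_iff] at hdx
    simpa [cornerVal_eq_zero_iff, cornerVal_injective.eq_iff] using
      h.eq_zero_or_eq d (isIdempotentElem_cornerVal_iff.1 hd) ((hcentral d).1 hd') hdx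

lemma isCentralPrimitive_iff_isIndecomposableRing_corner {c : S} (hc : IsIdempotentElem c)
    (hc' : ∀ s, c * s = s * c) : IsCentralPrimitive c ↔ IsIndecomposableRing hc.Corner := by
  rw [← isCentralPrimitive_one_iff, ← isCentralPrimitive_cornerVal_iff hc hc', cornerVal_one]

lemma IsCentralPrimitive.map_ringEquiv {T : Type w} [Ring T] (φ : S ≃+* T) {c : S}
    (h : IsCentralPrimitive c) : IsCentralPrimitive (φ c) := by
  refine ⟨h.idem.map φ, fun t => ?_, by simpa using h.ne_zero, fun d hd hd' hdc => ?_⟩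
  · obtain ⟨s, rfl⟩ := φ.surjective t
    rw [← map_mul, ← map_mul, h.central]
  · obtain ⟨d, rfl⟩ := φ.surjective d
    have := h.eq_zero_or_eq d (φ.injective (by simpa using hd.eq))
      (fun s => φ.injective (by simpa using hd' (φ s))) (φ.injective (by simpa using hdc))
    simpa using this

lemma isCentralPrimitive_piSingle {ι : Type*} [DecidableEq ι] (T : ι → Type w) [∀ i, Ring (T i)]
    (i : ι) (h : IsIndecomposableRing (T i)) :
    IsCentralPrimitive (Pi.single i 1 : ∀ i, T i) := by
  have := h.1
  refine ⟨?_, ?_, by simp, fun d hd hd' hdi => ?_⟩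
  · rw [IsIdempotentElem, ← Pi.single_mul, one_mul]
  · intro s
    ext j
    obtain rfl | hj := eq_or_ne j i <;> simp [*]
  · have hd0 : d = Pi.single i (d i) := by
      ext j
      rw [← hdi]
      obtain rfl | hj := eq_or_ne j i <;> simp [*]
    have := h.2 (d i) (congrFun hd i) (fun s => by simpa using congrFun (hd' (Pi.single i s)) i)
    rw [hd0]
    rcases this with h | h <;> simp [h]

/-- In a semiprime ring the Peirce trivial idempotents are the central ones: if `e` is Peirce
trivial and `x ∈ eR(1-e)`, then `xRx ⊆ (eR(1-e)Re)R(1-e) = 0`, so `x = 0`; likewise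
`(1-e)Re = 0`. -/
lemma IsSemiprimeRing.isPeirceTrivial_iff (hS : IsSemiprimeRing S) {e : S} :
    IsPeirceTrivial e ↔ IsIdempotentElem e ∧ ∀ s, e * s = s * e := by
  constructor
  · rintro ⟨he, h1, h2⟩
    refine ⟨he, fun s => ?_⟩
    have h3 : e * s * (1 - e) = 0 := hS _ fun r => by
      rw [show e * s * (1 - e) * r * (e * s * (1 - e)) =
        e * s * (1 - e) * r * e * (s * (1 - e)) by simp only [mul_assoc], h1, zero_mul]
    have h4 : (1 - e) * s * e = 0 := hS _ fun r => by
      rw [show (1 - e) * s * e * r * ((1 - e) * s * e) =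
        (1 - e) * s * e * r * (1 - e) * (s * e) by simp only [mul_assoc], h2, zero_mul]
    rw [mul_sub, mul_one, sub_eq_zero] at h3
    rw [sub_mul, sub_mul, one_mul, sub_eq_zero] at h4
    rw [h3, h4]
  · rintro ⟨he, h⟩
    refine ⟨he, fun r s => ?_, fun r s => ?_⟩
    · rw [h, mul_assoc r, he.mul_one_sub_self, mul_zero, zero_mul, zero_mul]
    · rw [mul_assoc (1 - e) r, ← h, ← mul_assoc, he.one_sub_mul_self, zero_mul, zero_mul, zero_mul]

lemma IsSemiprimeRing.isOnePeirceRing_iff (hS : IsSemiprimeRing S) :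
    IsOnePeirceRing S ↔ IsIndecomposableRing S := by
  simp only [IsOnePeirceRing, IsIndecomposableRing, hS.isPeirceTrivial_iff, and_imp]

lemma IsSemiprimeRing.corner (hS : IsSemiprimeRing S) {c : S} (hc : IsIdempotentElem c) :
    IsSemiprimeRing hc.Corner := by
  refine fun a h => cornerVal_eq_zero_iff.1 (hS _ fun r => ?_)
  have := congrArg (cornerVal hc) (h (toCorner hc r))
  simpa [cornerVal_toCorner, mul_assoc, mul_cornerVal, cornerVal_mul_assoc] using this

end Central

/-! ### Families of central primitive idempotents -/

section Family

variable {S : Type v} [Ring S] {n m : ℕ} {c : Fin n → S}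

lemma IsCentralPrimitive.mul_eq_zero_or_eq {c d : S} (hc : IsCentralPrimitive c)
    (hd : IsIdempotentElem d) (hd' : ∀ s, d * s = s * d) : d * c = 0 ∨ d * c = c :=
  hc.eq_zero_or_eq _
    (by rw [IsIdempotentElem, mul_assoc, ← mul_assoc c, hc.central d, mul_assoc d c, hc.idem.eq,
      ← mul_assoc, hd.eq])
    (fun s => by rw [mul_assoc, hc.central, ← mul_assoc, hd', mul_assoc s])
    (by rw [mul_assoc, hc.idem.eq])

/-- Every central idempotent is a partial sum of a complete orthogonal family of central primitive
idempotents. -/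
lemma exists_finset_sum_eq (hc : ∀ i, IsCentralPrimitive (c i)) (hsum : ∑ i, c i = 1)
    {d : S} (hd : IsIdempotentElem d) (hd' : ∀ s, d * s = s * d) :
    ∃ I : Finset (Fin n), ∑ i ∈ I, c i = d := by
  classical
  refine ⟨Finset.univ.filter fun i => d * c i = c i, ?_⟩
  have hdsum : d = ∑ i, d * c i := by rw [← Finset.mul_sum, hsum, mul_one]
  refine Eq.trans ?_ hdsum.symm
  rw [Finset.sum_filter]
  refine Finset.sum_congr rfl fun i _ => ?_
  split_ifs with h
  · exact h.symm
  · exact (((hc i).mul_eq_zero_or_eq hd hd').resolve_right h).symm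

/-- Two complete orthogonal families of central primitive idempotents agree up to a bijection of
their index sets. -/
lemma exists_equiv_eq (ho : OrthogonalIdempotents c) (hc : ∀ i, IsCentralPrimitive (c i))
    (hsum : ∑ i, c i = 1) {d : Fin m → S} (hdo : OrthogonalIdempotents d)
    (hd : ∀ i, IsCentralPrimitive (d i)) (hdsum : ∑ i, d i = 1) :
    ∃ σ : Fin n ≃ Fin m, ∀ i, c i = d (σ i) := by
  have key : ∀ {k l : ℕ} {a : Fin k → S} {b : Fin l → S}, (∀ i, IsCentralPrimitive (a i)) →
      (∀ i, IsCentralPrimitive (b i)) → ∑ i, b i = 1 → ∀ i, ∃ j, a i = b j := by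
    intro k l a b ha hb hb1 i
    -- As `a i = ∑ a i * b j` is nonzero, so is some `a i * b j`, which then equals both factors.
    have : ∃ j, a i * b j ≠ 0 := by
      by_contra! h
      exact (ha i).ne_zero (by rw [← mul_one (a i), ← hb1, Finset.mul_sum]; simp [h])
    obtain ⟨j, hj⟩ := this
    refine ⟨j, ?_⟩
    rw [← ((hb j).mul_eq_zero_or_eq (ha i).idem (ha i).central).resolve_left hj]
    have := (ha i).mul_eq_zero_or_eq (hb j).idem (hb j).central
    rw [← (ha i).central] at this
    exact (this.resolve_left hj).symm
  have inj : ∀ {k : ℕ} {a : Fin k → S}, OrthogonalIdempotents a →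
      (∀ i, IsCentralPrimitive (a i)) → Function.Injective a := by
    intro k a ha ha' i j hij
    by_contra hne
    have : a i * a j = 0 := ha.ortho hne
    rw [hij, (ha.idem j).eq] at this
    exact (ha' j).ne_zero this
  choose f hf using key hc hd hdsum
  choose g hg using key hd hc hsum
  refine ⟨⟨f, g, fun i => inj ho hc ?_, fun j => inj hdo hd ?_⟩, hf⟩
  · rw [← hg, ← hf]
  · rw [← hf, ← hg]

end Family

/-! ### The factor by the prime radical -/

/-- A model of the factor of `R` by its prime radical: a surjective ring homomorphism whose kernel
is `B(R)`. Working with models rather than with `R ⧸ B(R)` itself allows `ē(R/B(R))ē` to stand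
for the factor of `eRe` by its prime radical. -/
structure IsPrimeRadicalQuotient {R : Type u} {S : Type v} [Ring R] [Ring S] (φ : R →+* S) :
    Prop where
  surjective : Function.Surjective φ
  map_eq_zero_iff : ∀ x, φ x = 0 ↔ x ∈ primeRadical R

lemma isPrimeRadicalQuotient_mk (R : Type u) [Ring R] :
    IsPrimeRadicalQuotient (Ideal.Quotient.mk (TwoSidedIdeal.asIdeal (primeRadical R))) :=
  ⟨Ideal.Quotient.mk_surjective, fun x => by
    rw [Ideal.Quotient.eq_zero_iff_mem, TwoSidedIdeal.mem_asIdeal]⟩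

lemma cornerVal_toCorner_map {R : Type u} {S : Type v} [Ring R] [Ring S] (φ : R →+* S) {e : R}
    (he : IsIdempotentElem e) (x : he.Corner) :
    cornerVal (he.map φ) (toCorner (he.map φ) (φ (cornerVal he x))) = φ (cornerVal he x) := by
  rw [cornerVal_toCorner, ← map_mul, ← map_mul, mul_cornerVal, cornerVal_mul]

/-- The homomorphism of corner rings `eRe → φ(e) S φ(e)` induced by `φ : R → S`. -/
def cornerMap {R : Type u} {S : Type v} [Ring R] [Ring S] (φ : R →+* S) {e : R}
    (he : IsIdempotentElem e) : he.Corner →+* (he.map φ).Corner where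
  toFun x := toCorner (he.map φ) (φ (cornerVal he x))
  map_one' := cornerVal_injective (by rw [cornerVal_toCorner_map, cornerVal_one, cornerVal_one])
  map_mul' x y := cornerVal_injective (by
    rw [cornerVal_toCorner_map, map_mul, map_mul, map_mul, cornerVal_toCorner_map,
      cornerVal_toCorner_map])
  map_zero' := cornerVal_injective (by simp [cornerVal_toCorner])
  map_add' x y := cornerVal_injective (by simp [cornerVal_toCorner, mul_add, add_mul])

namespace IsPrimeRadicalQuotient

variable {R : Type u} {S : Type v} [Ring R] [Ring S] {φ : R →+* S}

lemma cornerVal_cornerMap {e : R} (he : IsIdempotentElem e) (x : he.Corner) :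
    cornerVal (he.map φ) (cornerMap φ he x) = φ (cornerVal he x) :=
  cornerVal_toCorner_map φ he x

variable (h : IsPrimeRadicalQuotient φ)
include h

lemma corner {e : R} (he : IsIdempotentElem e) : IsPrimeRadicalQuotient (cornerMap φ he) := by
  refine ⟨fun y => ?_, fun x => ?_⟩
  · obtain ⟨r, hr⟩ := h.surjective (cornerVal _ y)
    refine ⟨toCorner he r, cornerVal_injective ?_⟩
    rw [cornerVal_cornerMap, cornerVal_toCorner, map_mul, map_mul, hr, mul_cornerVal,
      cornerVal_mul]
  · rw [← cornerVal_eq_zero_iff, cornerVal_cornerMap, h.map_eq_zero_iff,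
      mem_primeRadical_corner_iff]

lemma isNilpotent_of_mem_ker : ∀ x ∈ RingHom.ker φ, IsNilpotent x := fun x hx =>
  isNilpotent_of_mem_primeRadical ((h.map_eq_zero_iff x).1 hx)

lemma isSemiprimeRing : IsSemiprimeRing S := by
  intro a ha
  obtain ⟨a, rfl⟩ := h.surjective a
  rw [h.map_eq_zero_iff]
  refine mem_primeRadical_of_mul_mul_mem fun r => ?_
  rw [← h.map_eq_zero_iff, map_mul, map_mul, ha]

/-- Modulo the prime radical, `B`-triviality becomes Peirce triviality in a semiprime ring, that is,
centrality. -/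
lemma isBTrivial_iff {e : R} :
    IsBTrivial e ↔ IsIdempotentElem e ∧ ∀ s, φ e * s = s * φ e := by
  constructor
  · rintro ⟨he, h1, h2⟩
    refine ⟨he, (h.isSemiprimeRing.isPeirceTrivial_iff.1 ⟨he.map φ, ?_, ?_⟩).2⟩
    · refine h.surjective.forall₂.2 fun r s => ?_
      simpa using (h.map_eq_zero_iff _).2 (h1 r s)
    · refine h.surjective.forall₂.2 fun r s => ?_
      simpa using (h.map_eq_zero_iff _).2 (h2 r s)
  · rintro ⟨he, h1⟩
    obtain ⟨-, h2, h3⟩ := h.isSemiprimeRing.isPeirceTrivial_iff.2 ⟨he.map φ, h1⟩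
    refine ⟨he, fun r s => (h.map_eq_zero_iff _).1 ?_, fun r s => (h.map_eq_zero_iff _).1 ?_⟩
    · simpa using h2 (φ r) (φ s)
    · simpa using h3 (φ r) (φ s)

lemma eq_zero_of_map_eq_zero {e : R} (he : IsIdempotentElem e) (h0 : φ e = 0) : e = 0 :=
  eq_zero_of_isIdempotentElem_of_mem_primeRadical he ((h.map_eq_zero_iff e).1 h0)

lemma eq_one_of_map_eq_one {e : R} (he : IsIdempotentElem e) (h1 : φ e = 1) : e = 1 :=
  (sub_eq_zero.1 (h.eq_zero_of_map_eq_zero he.one_sub (by simp [h1]))).symm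

lemma exists_lift {c : S} (hc : IsIdempotentElem c) : ∃ e, IsIdempotentElem e ∧ φ e = c :=
  exists_isIdempotentElem_eq_of_ker_isNilpotent φ h.isNilpotent_of_mem_ker c (h.surjective c) hc

/-- Central idempotents of the factor lift to `B`-trivial idempotents of `R`, and an idempotent of
`R` mapping to `0` or `1` is `0` or `1`. -/
lemma isOneBRing_iff : IsOneBRing R ↔ IsIndecomposableRing S := by
  constructor
  · rintro ⟨_, h1⟩
    refine ⟨⟨1, 0, fun h0 => ?_⟩, fun c hc hc' => ?_⟩
    · exact one_ne_zero (h.eq_zero_of_map_eq_zero (e := (1 : R)) .one (by rw [map_one, h0]))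
    · obtain ⟨e, he, rfl⟩ := h.exists_lift hc
      rcases h1 e (h.isBTrivial_iff.2 ⟨he, hc'⟩) with rfl | rfl <;> simp
  · rintro ⟨_, h1⟩
    refine ⟨φ.domain_nontrivial, fun e he => ?_⟩
    rw [h.isBTrivial_iff] at he
    exact (h1 _ (he.1.map φ) he.2).imp (h.eq_zero_of_map_eq_zero he.1)
      (h.eq_one_of_map_eq_one he.1)

/-- An idempotent `e` is `B`-trivial with `eRe` a `1`-`B` ring exactly when its
image modulo the prime radical is a central primitive idempotent. -/
lemma isCentralPrimitive_map_iff {e : R} (he : IsIdempotentElem e) :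
    IsCentralPrimitive (φ e) ↔ IsBTrivial e ∧ IsOneBRing he.Corner := by
  rw [(h.corner he).isOneBRing_iff, h.isBTrivial_iff]
  constructor
  · intro hc
    exact ⟨⟨he, hc.central⟩,
      (isCentralPrimitive_iff_isIndecomposableRing_corner (he.map φ) hc.central).1 hc⟩
  · rintro ⟨⟨-, h1⟩, h2⟩
    exact (isCentralPrimitive_iff_isIndecomposableRing_corner (he.map φ) h1).2 h2

lemma isOrthogonalOneBFamily_iff {n : ℕ} {e : Fin n → R} :
    IsOrthogonalOneBFamily e ↔
      OrthogonalIdempotents e ∧ ∀ i, IsCentralPrimitive (φ (e i)) := by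
  constructor
  · intro he
    exact ⟨he.toOrthogonalIdempotents, fun i =>
      (h.isCentralPrimitive_map_iff (he.idem i)).2 ⟨he.bTrivial i, he.corner i⟩⟩
  · rintro ⟨ho, hc⟩
    exact ⟨ho, fun i => ((h.isCentralPrimitive_map_iff (ho.idem i)).1 (hc i)).1,
      fun i => ((h.isCentralPrimitive_map_iff (ho.idem i)).1 (hc i)).2⟩

/-- Being `B`-trivial with `1`-`B` corner ring means the same in `eRe` as in `R`, if `e` is
`B`-trivial. -/
lemma isCentralPrimitive_cornerMap_iff {e : R} (he : IsBTrivial e) (x : he.1.Corner) :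
    IsCentralPrimitive (cornerMap φ he.1 x) ↔ IsCentralPrimitive (φ (cornerVal he.1 x)) := by
  rw [← isCentralPrimitive_cornerVal_iff (he.1.map φ) (h.isBTrivial_iff.1 he).2,
    cornerVal_cornerMap]

/-- Idempotent families with the same image modulo the prime radical, the first of which is
complete, are conjugate by `u = ∑ eᵢ fᵢ`, which is `1` modulo the prime radical. -/
lemma exists_unit_conj {ι : Type*} [Fintype ι] {e f : ι → R}
    (he : CompleteOrthogonalIdempotents e) (hf : OrthogonalIdempotents f)
    (hef : ∀ i, φ (e i) = φ (f i)) :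
    ∃ u : Rˣ, φ u = 1 ∧ ∀ i, e i = u * f i * (u⁻¹ : Rˣ) := by
  classical
  set u := ∑ i, e i * f i with hu
  have hφu : φ u = 1 := by
    simp only [hu, map_sum, map_mul, ← hef]
    rw [← map_one φ, ← he.complete, map_sum]
    exact Finset.sum_congr rfl fun i _ => by rw [← map_mul, (he.idem i).eq]
  have hunit : IsUnit u := by
    have : IsNilpotent (1 - u) := h.isNilpotent_of_mem_ker _ (by simp [RingHom.mem_ker, hφu])
    simpa using this.isUnit_one_sub
  obtain ⟨v, hv⟩ := hunit
  refine ⟨v, by rw [hv, hφu], fun i => ?_⟩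
  rw [eq_comm, Units.mul_inv_eq_iff_eq_mul, hv, hu, Finset.sum_mul, Finset.mul_sum]
  refine Finset.sum_congr rfl fun j _ => ?_
  rw [mul_assoc, hf.mul_eq, ← mul_assoc, he.mul_eq]
  rcases eq_or_ne j i with rfl | hji
  · simp
  · simp [hji, hji.symm]

end IsPrimeRadicalQuotient

/-! ### Complete families and the inductive definition -/

section Inductive

variable {R : Type u} [Ring R]

lemma IsBTrivial.one_sub {e : R} (he : IsBTrivial e) : IsBTrivial (1 - e) := by
  have h := isPrimeRadicalQuotient_mk R
  rw [h.isBTrivial_iff] at he ⊢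
  exact ⟨he.1.one_sub, fun s => by rw [map_sub, map_one, sub_mul, mul_sub, he.2, one_mul, mul_one]⟩

/-- Complete families of `eRe` and `(1-e)R(1-e)` combine to one of `R`. -/
lemma exists_family_of_corners {e : R} (he : IsIdempotentElem e) (hB : IsBTrivial e) {k l : ℕ}
    {a : Fin k → he.Corner} {b : Fin l → he.one_sub.Corner}
    (ha : IsOrthogonalOneBFamily a) (ha1 : ∑ i, a i = 1)
    (hb : IsOrthogonalOneBFamily b) (hb1 : ∑ i, b i = 1) :
    ∃ c : Fin (k + l) → R, IsOrthogonalOneBFamily c ∧ ∑ i, c i = 1 := by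
  have h := isPrimeRadicalQuotient_mk R
  have ha' := ((h.corner he).isOrthogonalOneBFamily_iff.1 ha).2
  have hb' := ((h.corner he.one_sub).isOrthogonalOneBFamily_iff.1 hb).2
  let c : Fin (k + l) → R :=
    Fin.append (fun i => cornerVal he (a i)) (fun i => cornerVal he.one_sub (b i))
  have hc : CompleteOrthogonalIdempotents c := by
    refine CompleteOrthogonalIdempotents.iff_ortho_complete.2 ⟨fun i j hij => ?_, ?_⟩
    · change c i * c j = 0
      induction i using Fin.addCases with
      | left i =>
        induction j using Fin.addCases with
        | left j =>
          have : a i * a j = 0 := ha.ortho fun h => hij (by rw [h])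
          simp only [c, Fin.append_left]
          rw [← map_mul, this, map_zero]
        | right j =>
          simp only [c, Fin.append_left, Fin.append_right]
          rw [← cornerVal_mul (a i), ← mul_cornerVal (b j), mul_assoc, ← mul_assoc e,
            he.mul_one_sub_self, zero_mul, mul_zero]
      | right i =>
        induction j using Fin.addCases with
        | left j =>
          simp only [c, Fin.append_left, Fin.append_right]
          rw [← cornerVal_mul (b i), ← mul_cornerVal (a j), mul_assoc, ← mul_assoc (1 - e),
            he.one_sub_mul_self, zero_mul, mul_zero]
        | right j =>
          have : b i * b j = 0 := hb.ortho fun h => hij (by rw [h])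
          simp only [c, Fin.append_right]
          rw [← map_mul, this, map_zero]
    · simp only [c, Fin.sum_univ_add, Fin.append_left, Fin.append_right]
      rw [← map_sum, ← map_sum, ha1, hb1, cornerVal_one, cornerVal_one, add_sub_cancel]
  refine ⟨c, h.isOrthogonalOneBFamily_iff.2 ⟨hc.toOrthogonalIdempotents, fun i => ?_⟩, hc.complete⟩
  induction i using Fin.addCases with
  | left i =>
    simp only [c, Fin.append_left]
    exact (h.isCentralPrimitive_cornerMap_iff hB _).1 (ha' i)
  | right i =>
    simp only [c, Fin.append_right]
    exact (h.isCentralPrimitive_cornerMap_iff hB.one_sub _).1 (hb' i)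

lemma IsNBRing.exists_family {n : ℕ} (h : IsNBRing n R) :
    ∃ e : Fin n → R, IsOrthogonalOneBFamily e ∧ ∑ i, e i = 1 := by
  induction h with
  | @one R _ h1 =>
    have h := isPrimeRadicalQuotient_mk R
    refine ⟨fun _ => 1, h.isOrthogonalOneBFamily_iff.2
      ⟨OrthogonalIdempotents.unique.2 .one, fun _ => ?_⟩, by simp⟩
    rw [map_one, isCentralPrimitive_one_iff, ← h.isOneBRing_iff]
    exact h1
  | @step R _ n m hm hmn e he hB h₁ h₂ ih₁ ih₂ =>
    obtain ⟨a, ha, ha1⟩ := ih₁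
    obtain ⟨b, hb, hb1⟩ := ih₂
    have := exists_family_of_corners he hB ha ha1 hb hb1
    rwa [Nat.add_sub_cancel' hmn.le] at this

/-- Splitting off the first member of a complete family leaves a complete family of
`(1-e₀)R(1-e₀)`. -/
lemma IsOrthogonalOneBFamily.isNBRing {n : ℕ} {e : Fin (n + 1) → R}
    (he : IsOrthogonalOneBFamily e) (h1 : ∑ i, e i = 1) : IsNBRing (n + 1) R := by
  induction n generalizing R with
  | zero =>
    have h := isPrimeRadicalQuotient_mk R
    refine .one (h.isOneBRing_iff.2 (isCentralPrimitive_one_iff.1 ?_))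
    rw [← map_one (Ideal.Quotient.mk _), ← h1, Fin.sum_univ_one]
    exact (h.isOrthogonalOneBFamily_iff.1 he).2 0
  | succ n ih =>
    have h := isPrimeRadicalQuotient_mk R
    have h0 := he.idem 0
    have hval : ∀ i : Fin (n + 1),
        cornerVal h0.one_sub (toCorner h0.one_sub (e i.succ)) = e i.succ := by
      intro i
      have h3 : e 0 * e i.succ = 0 := he.ortho (Fin.succ_ne_zero i).symm
      have h4 : e i.succ * e 0 = 0 := he.ortho (Fin.succ_ne_zero i)
      simp [cornerVal_toCorner, sub_mul, mul_sub, h3, h4]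
    have hg : CompleteOrthogonalIdempotents
        (fun i : Fin (n + 1) => toCorner h0.one_sub (e i.succ)) := by
      refine CompleteOrthogonalIdempotents.iff_ortho_complete.2 ⟨fun i j hij => ?_, ?_⟩
      · refine cornerVal_injective ?_
        rw [map_mul, hval, hval, map_zero]
        exact he.ortho fun h => hij (Fin.succ_injective _ h)
      · refine cornerVal_injective ?_
        rw [map_sum, cornerVal_one, Finset.sum_congr rfl fun i _ => hval i, eq_sub_iff_add_eq',
          ← Fin.sum_univ_succ, h1]
    have hgf : IsOrthogonalOneBFamily
        (fun i : Fin (n + 1) => toCorner h0.one_sub (e i.succ)) := by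
      refine (h.corner h0.one_sub).isOrthogonalOneBFamily_iff.2
        ⟨hg.toOrthogonalIdempotents, fun i => ?_⟩
      refine (h.isCentralPrimitive_cornerMap_iff (he.bTrivial 0).one_sub _).2 ?_
      rw [hval]
      exact (h.isOrthogonalOneBFamily_iff.1 he).2 i.succ
    refine .step le_rfl (by lia) h0 (he.bTrivial 0) (.one (he.corner 0)) ?_
    exact ih hgf hg.complete

/-- Two complete families have the same image modulo the prime radical, up to a bijection, so that
they are conjugate. -/
lemma IsOrthogonalOneBFamily.exists_conj {n m : ℕ} {e : Fin n → R} {f : Fin m → R}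
    (he : IsOrthogonalOneBFamily e) (he1 : ∑ i, e i = 1) (hf : IsOrthogonalOneBFamily f)
    (hf1 : ∑ j, f j = 1) :
    m = n ∧ ∃ (σ : Fin n ≃ Fin m) (u : Rˣ), ∀ i, e i = u * f (σ i) * (u⁻¹ : Rˣ) := by
  have h := isPrimeRadicalQuotient_mk R
  obtain ⟨σ, hσ⟩ := exists_equiv_eq (he.toOrthogonalIdempotents.map (Ideal.Quotient.mk _))
    (h.isOrthogonalOneBFamily_iff.1 he).2
    (by simp only [Function.comp_apply, ← map_sum, he1, map_one])
    (hf.toOrthogonalIdempotents.map (Ideal.Quotient.mk _)) (h.isOrthogonalOneBFamily_iff.1 hf).2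
    (by simp only [Function.comp_apply, ← map_sum, hf1, map_one])
  obtain ⟨u, -, hu⟩ := h.exists_unit_conj ⟨he.toOrthogonalIdempotents, he1⟩
    ((OrthogonalIdempotents.equiv σ).2 hf.toOrthogonalIdempotents) hσ
  exact ⟨by simpa using (Fintype.card_congr σ).symm, σ, u, hu⟩

end Inductive

/-! ### Product decompositions of the factor by the prime radical -/

section Product

variable {R : Type u} [Ring R]

/-- A complete family of `R` maps to a decomposition of `1` into central primitive idempotents of
`R / B(R)`, whose corner rings are the factors of the product; conversely, the identities of the
factors of a product lift to a complete family. -/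
lemma exists_family_iff_exists_ringEquiv {n : ℕ} :
    (∃ e : Fin n → R, IsOrthogonalOneBFamily e ∧ ∑ i, e i = 1) ↔
      ∃ (S : Fin n → Type u) (_ : ∀ i, Ring (S i)),
        (∀ i, IsSemiprimeRing (S i) ∧ IsOnePeirceRing (S i)) ∧
          Nonempty (ModPrimeRadical R ≃+* ∀ i, S i) := by
  have h := isPrimeRadicalQuotient_mk R
  constructor
  · rintro ⟨e, he, he1⟩
    obtain ⟨ho, hc⟩ := h.isOrthogonalOneBFamily_iff.1 he
    have hco : CompleteOrthogonalIdempotents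
        (Ideal.Quotient.mk (primeRadical R).asIdeal ∘ e) :=
      CompleteOrthogonalIdempotents.map _ ⟨ho, he1⟩
    refine ⟨fun i => (hco.idem i).Corner, inferInstance, fun i => ?_,
      ⟨hco.ringEquivOfIsMulCentral fun i => Semigroup.mem_center_iff.2 fun s =>
        ((hc i).central s).symm⟩⟩
    have hs := h.isSemiprimeRing.corner (hco.idem i)
    exact ⟨hs, hs.isOnePeirceRing_iff.2
      ((isCentralPrimitive_iff_isIndecomposableRing_corner _ (hc i).central).1 (hc i))⟩
  · rintro ⟨S, _, hS, ⟨ψ⟩⟩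
    have hco : CompleteOrthogonalIdempotents
        (ψ.symm.toRingHom ∘ fun i => (Pi.single i 1 : ∀ i, S i)) :=
      (CompleteOrthogonalIdempotents.single S).map _
    obtain ⟨e, he, hφe⟩ := hco.lift_of_isNilpotent_ker _ h.isNilpotent_of_mem_ker
      fun i => h.surjective _
    refine ⟨e, h.isOrthogonalOneBFamily_iff.2 ⟨he.toOrthogonalIdempotents, fun i => ?_⟩,
      he.complete⟩
    rw [show Ideal.Quotient.mk (primeRadical R).asIdeal (e i) = _ from congrFun hφe i]
    exact (isCentralPrimitive_piSingle S i
      ((hS i).1.isOnePeirceRing_iff.1 (hS i).2)).map_ringEquiv ψ.symm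

lemma isNBRing_iff_exists_family {n : ℕ} (hn : 1 ≤ n) :
    IsNBRing n R ↔ ∃ e : Fin n → R, IsOrthogonalOneBFamily e ∧ ∑ i, e i = 1 := by
  obtain ⟨n, rfl⟩ := Nat.exists_eq_add_of_le' hn
  exact ⟨IsNBRing.exists_family, fun ⟨e, he, he1⟩ => he.isNBRing he1⟩

end Product

/-! ### Decomposition of `B`-trivial idempotents -/

section Decomposition

variable {R : Type u} [Ring R]

lemma IsOneBRing.isIndecomposableRing (h : IsOneBRing R) : IsIndecomposableRing R :=
  ⟨h.1, fun e he hc => h.2 e ((isPrimeRadicalQuotient_mk R).isBTrivial_iff.2 ⟨he,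
    Ideal.Quotient.mk_surjective.forall.2 fun s => by rw [← map_mul, ← map_mul, hc]⟩)⟩

/-- Right multiplication by `u` is an isomorphism `Re ≃ Rf` if `e = u f u⁻¹`. -/
lemma nonempty_span_linearEquiv_of_conj {e f : R} (u : Rˣ) (h : e = u * f * (u⁻¹ : Rˣ)) :
    Nonempty (Ideal.span {e} ≃ₗ[R] Ideal.span {f}) := by
  have h1 : e * u = u * f := by rw [h, mul_assoc, Units.inv_mul, mul_one]
  have h2 : f * (u⁻¹ : Rˣ) = (u⁻¹ : Rˣ) * e := by
    rw [h, mul_assoc, Units.inv_mul_cancel_left]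
  have mem : ∀ {a b : R} (v w : R), a * v = w * b →
      ∀ x ∈ Ideal.span {a}, x * v ∈ Ideal.span {b} := by
    intro a b v w hab x hx
    obtain ⟨r, rfl⟩ := Ideal.mem_span_singleton'.1 hx
    exact Ideal.mem_span_singleton'.2 ⟨r * w, by rw [mul_assoc, mul_assoc, hab]⟩
  exact ⟨{
    toFun := fun x => ⟨x.1 * u, mem _ _ h1 x.1 x.2⟩
    invFun := fun y => ⟨y.1 * (u⁻¹ : Rˣ), mem _ _ h2 y.1 y.2⟩
    map_add' := fun x y => Subtype.ext (add_mul _ _ _)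
    map_smul' := fun r x => Subtype.ext (mul_assoc _ _ _)
    left_inv := fun x => Subtype.ext (Units.mul_inv_cancel_right _ _)
    right_inv := fun y => Subtype.ext (Units.inv_mul_cancel_right _ _) }⟩

/-- Modulo the prime radical, `f` is a partial sum of the family `e`; a unit conjugating that
partial sum to `f` conjugates the members of the sum to a decomposition of `f`. -/
lemma IsOrthogonalOneBFamily.exists_decomposition {n : ℕ} {e : Fin n → R}
    (he : IsOrthogonalOneBFamily e) (he1 : ∑ i, e i = 1) {f : R} (hf : IsBTrivial f) :
    ∃ I : Finset (Fin n), ∃ g : Fin I.card → R, IsOrthogonalOneBFamily g ∧ ∑ j, g j = f ∧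
      Nonempty (Ideal.span {∑ i ∈ I, e i} ≃ₗ[R] Ideal.span {f}) := by
  have h := isPrimeRadicalQuotient_mk R
  set φ := Ideal.Quotient.mk (primeRadical R).asIdeal
  obtain ⟨ho, hc⟩ := h.isOrthogonalOneBFamily_iff.1 he
  obtain ⟨hfi, hfc⟩ := h.isBTrivial_iff.1 hf
  obtain ⟨I, hI⟩ := exists_finset_sum_eq hc (by rw [← map_sum, he1, map_one]) (hfi.map φ) hfc
  rw [← map_sum] at hI
  -- Conjugate the complete families `(e', 1 - e')`, `e' = ∑ i ∈ I, e i`, and `(f, 1 - f)`.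
  obtain ⟨u, hu1, hu⟩ := h.exists_unit_conj
    (.of_isIdempotentElem (ho.isIdempotentElem_sum (s := I)))
    (CompleteOrthogonalIdempotents.of_isIdempotentElem hfi).toOrthogonalIdempotents
    (fun i => by fin_cases i <;> simp [hI])
  have hu := hu 0
  simp only [Matrix.cons_val_zero] at hu
  have hui : φ (u⁻¹ : Rˣ) = 1 := by
    have := congrArg φ u.inv_mul
    rwa [map_mul, hu1, mul_one, map_one] at this
  let ι : Fin I.card ≃ I := I.equivFin.symm
  refine ⟨I, fun j => (u⁻¹ : Rˣ) * e (ι j) * u, h.isOrthogonalOneBFamily_iff.2 ⟨⟨fun j => ?_,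
    fun j k hjk => ?_⟩, fun j => ?_⟩, ?_, nonempty_span_linearEquiv_of_conj u hu⟩
  · have := (ho.idem (ι j)).eq
    simp only [IsIdempotentElem, mul_assoc, Units.mul_inv_cancel_left]
    rw [← mul_assoc (e _) (e _), this]
  · have : e (ι j) * e (ι k) = 0 :=
      ho.ortho fun h => hjk (ι.injective (Subtype.ext h))
    simp only [mul_assoc, Units.mul_inv_cancel_left]
    rw [← mul_assoc (e _) (e _), this, zero_mul, mul_zero]
  · simpa [hui, hu1] using hc (ι j)
  · rw [← Finset.sum_mul, ← Finset.mul_sum, ι.sum_comp (fun i : I => e i),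
      Finset.sum_coe_sort I e, hu]
    simp [mul_assoc]

end Decomposition

/-! ### Structure of `n`-`B` rings -/

theorem mainTheorem7 {R : Type u} [Ring R] :
    -- the characterization, and the invariance of `n`
    (∀ n : ℕ, 1 ≤ n →
      (IsNBRing n R ↔
        ∃ (S : Fin n → Type u) (_ : ∀ i, Ring (S i)),
          (∀ i, IsSemiprimeRing (S i) ∧ IsOnePeirceRing (S i)) ∧
            Nonempty (ModPrimeRadical R ≃+* ∀ i, S i))) ∧
    (∀ m n : ℕ, IsNBRing m R → IsNBRing n R → m = n) ∧
    (∀ n : ℕ, IsNBRing n R →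
      ∃ e : Fin n → R, IsOrthogonalOneBFamily e ∧ ∑ i, e i = 1) ∧
    -- decomposition of `B`-trivial idempotents
    (∀ (n : ℕ) (e : Fin n → R), IsOrthogonalOneBFamily e → ∑ i, e i = 1 →
      ∀ f : R, IsBTrivial f →
        ∃ m : ℕ, m ≤ n ∧
          (∃ g : Fin m → R, ∃ hg : IsOrthogonalOneBFamily g, ∑ j, g j = f ∧
            ∀ j, IsIndecomposableRing (hg.idem j).Corner ∧
              IsSemiprimeRing (ModPrimeRadical (hg.idem j).Corner) ∧
              IsIndecomposableRing (ModPrimeRadical (hg.idem j).Corner)) ∧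
          ∃ I : Finset (Fin n), I.card = m ∧
            Nonempty (Ideal.span {∑ i ∈ I, e i} ≃ₗ[R] Ideal.span {f})) ∧
    -- any two complete sets have the same size and are conjugate up to a permutation
    (∀ (n m : ℕ) (e : Fin n → R) (f : Fin m → R),
      IsOrthogonalOneBFamily e → ∑ i, e i = 1 →
      IsOrthogonalOneBFamily f → ∑ j, f j = 1 →
        m = n ∧ ∃ (σ : Fin n ≃ Fin m) (u : Rˣ), ∀ i, e i = u * f (σ i) * (u⁻¹ : Rˣ)) := by
  refine ⟨fun n hn => ?_, fun m n hm hn => ?_, fun n h => h.exists_family,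
    fun n e he he1 f hf => ?_, fun n m e f he he1 hf hf1 => he.exists_conj he1 hf hf1⟩
  · rw [isNBRing_iff_exists_family hn, exists_family_iff_exists_ringEquiv]
  · obtain ⟨e, he, he1⟩ := hm.exists_family
    obtain ⟨f, hf, hf1⟩ := hn.exists_family
    exact (hf.exists_conj hf1 he he1).1
  · obtain ⟨I, g, hg, hgf, hI⟩ := he.exists_decomposition he1 hf
    refine ⟨I.card, by simpa using I.card_le_univ, ⟨g, hg, hgf, fun j => ?_⟩, I, rfl, hI⟩
    have h := isPrimeRadicalQuotient_mk (hg.idem j).Corner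
    exact ⟨(hg.corner j).isIndecomposableRing, h.isSemiprimeRing, h.isOneBRing_iff.1 (hg.corner j)⟩
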